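/- For a positive real number $m$ let $S_m=\{x\in\mathbb{R}^n : \langle x,x\rangle=m\}$ be the sphere of square radius $m$, and let $\sigma$ be the $\mathrm{O}(n)$-invariant probability measure on $S_m$. A set $X$ is called a \emph{spherical $t$-design} in $S_m$ if it is a nonempty finite subset of $S_m$ such that $$\frac{1}{|X|}\sum_{x\in X}P(x)=\int_{S_m}P(y)\,d\sigma(y)$$ for every real polynomial $P$ in $n$ variables of degree at most $t$. Let $\mathbb{Z}^n=\{(x_1,\dots,x_n)\in\mathbb{R}^n : x_i\in\mathbb{Z}\}$ be the cubic lattice of rank $n$; its shell of norm $m$ is $(\mathbb{Z}^n)_m=\{x\in\mathbb{Z}^n : \langle x,x\rangle=m\}$. (i) For every even positive integer $m$, the shell $(\mathbb{Z}^4)_m$ is a spherical $5$-design. (ii) For every positive integer $m$ of the form $m=4^a(8b+3)$ with integers $a,b\ge 0$, the shell $(\mathbb{Z}^7)_m$ is a spherical $5$-design. -/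

import Mathlib

open MeasureTheory

noncomputable section

/-- The cubic lattice `ℤⁿ` in Euclidean space `ℝⁿ`: the vectors with integer coordinates. -/
def cubicLattice (n : ℕ) : Set (EuclideanSpace ℝ (Fin n)) :=
  {x | ∀ i, ∃ k : ℤ, x i = k}

/-- The sphere of square radius `m`, centred at the origin of `ℝⁿ`. -/
def sphereOfNorm (n : ℕ) (m : ℝ) : Set (EuclideanSpace ℝ (Fin n)) :=
  {x | inner ℝ x x = m}

/-- The shell of norm `m` of a subset `A` of `ℝⁿ`: the `x ∈ A` with `⟪x, x⟫ = m`. -/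
def shell {n : ℕ} (A : Set (EuclideanSpace ℝ (Fin n))) (m : ℝ) :
    Set (EuclideanSpace ℝ (Fin n)) :=
  A ∩ sphereOfNorm n m

/-- The `O(n)`-invariant probability measure on the sphere of square radius `m` (`n ≥ 1`, `m > 0`),
seen as a measure on `ℝⁿ`: the surface measure of the unit sphere, normalised to total mass `1` and
transported by `u ↦ √m • u`. The three lemmas below record its characteristic properties. -/
def sphereProb (n : ℕ) (m : ℝ) : Measure (EuclideanSpace ℝ (Fin n)) :=
  Measure.map
    (fun u : Metric.sphere (0 : EuclideanSpace ℝ (Fin n)) 1 =>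
      Real.sqrt m • (u : EuclideanSpace ℝ (Fin n)))
    (((volume : Measure (EuclideanSpace ℝ (Fin n))).toSphere Set.univ)⁻¹ •
      (volume : Measure (EuclideanSpace ℝ (Fin n))).toSphere)

lemma measurable_sphereScale (n : ℕ) (m : ℝ) :
    Measurable (fun u : Metric.sphere (0 : EuclideanSpace ℝ (Fin n)) 1 =>
      Real.sqrt m • (u : EuclideanSpace ℝ (Fin n))) :=
  (continuous_subtype_val.const_smul (Real.sqrt m)).measurable

lemma isProbabilityMeasure_sphereProb {n : ℕ} (hn : 1 ≤ n) (m : ℝ) :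
    IsProbabilityMeasure (sphereProb n m) := by
  constructor
  have : Nonempty (Fin n) := ⟨⟨0, hn⟩⟩
  rw [sphereProb, Measure.map_apply (measurable_sphereScale n m) MeasurableSet.univ,
    Set.preimage_univ, Measure.smul_apply, smul_eq_mul]
  refine ENNReal.inv_mul_cancel ?_ (measure_ne_top _ _)
  rw [Ne, Measure.measure_univ_eq_zero]
  exact Measure.toSphere_ne_zero _

lemma sphereProb_compl_sphereOfNorm (n : ℕ) {m : ℝ} (hm : 0 ≤ m) :
    sphereProb n m (sphereOfNorm n m)ᶜ = 0 := by
  have hms : MeasurableSet (sphereOfNorm n m) :=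
    (isClosed_eq (by fun_prop) continuous_const).measurableSet
  rw [sphereProb, Measure.map_apply (measurable_sphereScale n m) hms.compl]
  refine (congrArg _ ?_).trans measure_empty
  ext u
  simp [sphereOfNorm, norm_smul, Real.sq_sqrt hm]

open scoped Pointwise in
lemma map_sphereProb {n : ℕ} (m : ℝ)
    (f : EuclideanSpace ℝ (Fin n) ≃ₗᵢ[ℝ] EuclideanSpace ℝ (Fin n)) :
    Measure.map f (sphereProb n m) = sphereProb n m := by
  have hf : Measurable f := f.continuous.measurable
  have hg := measurable_sphereScale n m
  ext s hs
  rw [Measure.map_apply hf hs, sphereProb, Measure.map_apply hg (hf hs), Measure.map_apply hg hs,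
    Measure.smul_apply, Measure.smul_apply, Measure.toSphere_apply' _ (hg (hf hs)),
    Measure.toSphere_apply' _ (hg hs)]
  congr 2
  symm
  rw [← (f.measurePreserving.measure_preimage_emb
    f.toHomeomorph.measurableEmbedding (Set.Ioo (0 : ℝ) 1 • _))]
  congr 1
  ext x
  simp only [Set.mem_smul, Set.mem_preimage, Set.mem_image]
  constructor
  · rintro ⟨r, hr, _, ⟨u, hu, rfl⟩, hx⟩
    refine ⟨r, hr, f.symm u, ⟨⟨f.symm u, by simp⟩, ?_, rfl⟩, ?_⟩
    · simpa using hu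
    · apply f.injective
      simpa using hx
  · rintro ⟨r, hr, _, ⟨u, hu, rfl⟩, rfl⟩
    refine ⟨r, hr, f u, ⟨⟨f u, by simp⟩, ?_, rfl⟩, by simp⟩
    simpa using hu

/-- `X` is a spherical `t`-design in the sphere of square radius `m` in `ℝⁿ`: a nonempty finite
subset of that sphere over which every real polynomial of degree at most `t` has the same average
as over the whole sphere. -/
structure IsSphericalDesign {n : ℕ} (t : ℕ) (m : ℝ) (X : Set (EuclideanSpace ℝ (Fin n))) :
    Prop where
  nonempty : X.Nonempty
  finite : X.Finite
  subset_sphere : X ⊆ sphereOfNorm n m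
  average_eq : ∀ P : MvPolynomial (Fin n) ℝ, P.totalDegree ≤ t →
    (1 / (X.ncard : ℝ)) * ∑ x ∈ finite.toFinset, MvPolynomial.eval (fun i => x i) P =
      ∫ y, MvPolynomial.eval (fun i => y i) P ∂(sphereProb n m)

end

/-! Sign changes, the radius and the symmetry between coordinates fix all moments of degree at most
5 once one more relation is known: the mean of `x i ^ 4` is three times that of `x i ^ 2 * x j ^ 2`
(`eq_of_sum_le`). The sphere satisfies it by invariance, and shells of `ℤⁿ` have all signed
permutations as symmetries, so a nonempty shell is a 5-design as soon as it satisfies this relation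
(`isSphericalDesign_shell`).

The relation comes from the reflection in a sum of four basis vectors, which keeps `x` integral when
the four coordinates have even sum (`quartic_relation`). In rank 4 with `m` even this sum is always
even, and the reflection suffices.

In rank 7 the reflections in the seven complements of Fano lines preserve the lattice of vectors
that reduce modulo 2 to the Hamming code, so `quarticDefect` sums to zero over its shells. To pass
to `ℤ⁷`, sort vectors by odd support: by permutation symmetry the layer sums depend only on the
weight of the support. Congruences leave only weight 3 if `m ≡ 3 (mod 8)`, and only weights 0 and 4
if `4 ∣ m`, where weight 0 is the doubled shell of norm `m / 4`. Each remaining weight occurs in the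
Hamming code, so its layers vanish; induction on `a` finishes. -/

/-- The relations among the moments of degree at most `5` of a probability distribution on the
sphere of square radius `m` that is symmetric under sign changes and is a spherical `5`-design. -/
structure IsQuinticMoments {n : ℕ} (m : ℝ) (M : (Fin n → ℕ) → ℝ) : Prop where
  zero : M 0 = 1
  odd : ∀ d i, Odd (d i) → M d = 0
  radial : ∀ d, ∑ j, M (d + Pi.single j 2) = m * M d
  second : ∀ i j, M (Pi.single i 2) = M (Pi.single j 2)
  fourth : ∀ i j, i ≠ j → M (Pi.single i 4) = 3 * M (Pi.single i 2 + Pi.single j 2)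

namespace IsQuinticMoments

variable {n : ℕ} {m : ℝ} {M M' : (Fin n → ℕ) → ℝ}

lemma single_two (h : IsQuinticMoments m M) (i : Fin n) : n * M (Pi.single i 2) = m := by
  have h1 := h.radial 0
  simp only [zero_add, h.zero, mul_one] at h1
  rw [← h1, Finset.sum_congr rfl fun j _ => h.second j i]
  simp

lemma single_four (h : IsQuinticMoments m M) (i : Fin n) :
    (n + 2) * M (Pi.single i 4) = 3 * m * M (Pi.single i 2) := by
  have h1 := h.radial (Pi.single i 2)
  have h2 : ∀ j, M (Pi.single i 2 + Pi.single j 2) =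
      M (Pi.single i 4) / 3 + if j = i then 2 / 3 * M (Pi.single i 4) else 0 := by
    intro j
    split_ifs with hj
    · subst hj
      rw [← Pi.single_add]
      ring
    · rw [h.fourth i j (Ne.symm hj)]
      ring
  rw [Finset.sum_congr rfl fun j _ => h2 j, Finset.sum_add_distrib] at h1
  simp at h1
  linarith

/-- The relations determine the moments of degree at most `5`. -/
lemma eq_of_sum_le (hn : 0 < n) (h : IsQuinticMoments m M) (h' : IsQuinticMoments m M')
    {d : Fin n → ℕ} (hd : ∑ i, d i ≤ 5) : M d = M' d := by
  have hn' : (0 : ℝ) < n := by exact_mod_cast hn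
  have h2 : ∀ i, M (Pi.single i 2) = M' (Pi.single i 2) := fun i => by
    have e := (h.single_two i).trans (h'.single_two i).symm
    exact mul_left_cancel₀ hn'.ne' e
  have h4 : ∀ i, M (Pi.single i 4) = M' (Pi.single i 4) := fun i => by
    have e := h.single_four i
    rw [h2, ← h'.single_four i] at e
    exact mul_left_cancel₀ (by positivity) e
  by_cases hodd : ∃ i, Odd (d i)
  · obtain ⟨i, hi⟩ := hodd
    rw [h.odd d i hi, h'.odd d i hi]
  push Not at hodd
  -- With all exponents even, squares can be peeled off one at a time; degree at most 5 allows at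
  -- most two of them.
  have split : ∀ d : Fin n → ℕ, (∀ i, ¬ Odd (d i)) → d ≠ 0 →
      ∃ (i : Fin n) (e : Fin n → ℕ), d = e + Pi.single i 2 ∧ (∀ i, ¬ Odd (e i)) ∧
        ∑ j, d j = ∑ j, e j + 2 := by
    intro d hev hne
    obtain ⟨i, hi⟩ := Function.ne_iff.1 hne
    have hi2 : 2 ≤ d i := by
      have := hev i
      rw [Nat.not_odd_iff_even] at this
      obtain ⟨r, hr⟩ := this
      simp at hi
      omega
    have hde : d = (d - Pi.single i 2) + Pi.single i 2 := by
      ext j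
      by_cases hj : j = i
      · subst hj
        simp; omega
      · simp [hj]
    refine ⟨i, d - Pi.single i 2, hde, ?_, ?_⟩
    · intro j
      by_cases hj : j = i
      · subst hj
        have := hev j
        simp [Nat.odd_iff] at *
        omega
      · simpa [Pi.single_apply, hj] using hev j
    · conv_lhs => rw [hde]
      simp [Finset.sum_add_distrib, Finset.sum_pi_single']
  by_cases d0 : d = 0
  · rw [d0, h.zero, h'.zero]
  obtain ⟨i, e, rfl, he, hs⟩ := split d hodd d0
  by_cases e0 : e = 0
  · rw [e0, zero_add, h2]
  obtain ⟨j, f, rfl, hf, hs'⟩ := split e he e0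
  have f0 : f = 0 := by
    by_contra f0
    obtain ⟨k, g, rfl, hg, hs''⟩ := split f hf f0
    omega
  subst f0
  rw [zero_add]
  by_cases hij : j = i
  · subst hij
    rw [← Pi.single_add, h4]
  · have e1 := h.fourth j i hij
    have e2 := h'.fourth j i hij
    rw [h4] at e1
    linarith

end IsQuinticMoments

/-! ### Moments of the sphere. -/

lemma prod_pow_single {n : ℕ} (y : Fin n → ℝ) (i : Fin n) (k : ℕ) :
    ∏ t, y t ^ (Pi.single i k : Fin n → ℕ) t = y i ^ k := by
  rw [Finset.prod_eq_single i] <;> simp +contextual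

lemma prod_pow_add {n : ℕ} (y : Fin n → ℝ) (d e : Fin n → ℕ) :
    ∏ t, y t ^ (d + e) t = (∏ t, y t ^ d t) * ∏ t, y t ^ e t := by
  simp [pow_add, Finset.prod_mul_distrib]

lemma prod_pow_neg_coord {n : ℕ} (y : Fin n → ℝ) (d : Fin n → ℕ) (i : Fin n) (hi : Odd (d i)) :
    ∏ t, (if t = i then -y t else y t) ^ d t = -∏ t, y t ^ d t := by
  have h : ∀ t, (if t = i then -y t else y t) ^ d t =
      (if t = i then -1 else 1) * y t ^ d t := by
    intro t
    split_ifs with ht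
    · subst ht
      rw [hi.neg_pow, neg_one_mul]
    · rw [one_mul]
  rw [Finset.prod_congr rfl fun t _ => h t, Finset.prod_mul_distrib]
  simp

lemma integrable_sphereProb {n : ℕ} (hn : 0 < n) (m : ℝ) {f : EuclideanSpace ℝ (Fin n) → ℝ}
    (hf : Continuous f) : Integrable f (sphereProb n m) := by
  have : Nonempty (Fin n) := ⟨⟨0, hn⟩⟩
  rw [sphereProb, integrable_map_measure hf.aestronglyMeasurable
    (measurable_sphereScale n m).aemeasurable]
  refine Integrable.smul_measure ?_ ?_
  · have : Continuous (f ∘ fun u : Metric.sphere (0 : EuclideanSpace ℝ (Fin n)) 1 =>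
        Real.sqrt m • (u : EuclideanSpace ℝ (Fin n))) :=
      hf.comp (continuous_subtype_val.const_smul (Real.sqrt m))
    exact this.integrable_of_hasCompactSupport (HasCompactSupport.of_compactSpace _)
  · rw [Ne, ENNReal.inv_eq_top, Measure.measure_univ_eq_zero]
    exact Measure.toSphere_ne_zero _

lemma integral_comp_sphereProb {n : ℕ} (m : ℝ)
    (f : EuclideanSpace ℝ (Fin n) ≃ₗᵢ[ℝ] EuclideanSpace ℝ (Fin n))
    (g : EuclideanSpace ℝ (Fin n) → ℝ) :
    ∫ y, g (f y) ∂(sphereProb n m) = ∫ y, g y ∂(sphereProb n m) := by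
  conv_rhs => rw [← map_sphereProb m f]
  exact (f.toHomeomorph.measurableEmbedding.integral_map g).symm

lemma integral_reflect_sphereProb {n : ℕ} (m : ℝ) (u : EuclideanSpace ℝ (Fin n))
    (g : (Fin n → ℝ) → ℝ) :
    ∫ y, g (fun t => y t - 2 * (inner ℝ u y / inner ℝ u u) * u t) ∂(sphereProb n m) =
      ∫ y, g (fun t => y t) ∂(sphereProb n m) := by
  rw [← integral_comp_sphereProb m (Submodule.reflection (ℝ ∙ u)ᗮ) (fun y => g fun t => y t)]
  congr 1 with y
  congr 1 with t
  rw [Submodule.reflection_orthogonal_apply, Submodule.reflection_singleton_apply]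
  simp only [real_inner_self_eq_norm_sq]
  simp [mul_assoc]

lemma inner_single_self {n : ℕ} (i : Fin n) (a : ℝ) (y : EuclideanSpace ℝ (Fin n)) :
    inner ℝ (EuclideanSpace.single i a) y = a * y i := by
  simp [EuclideanSpace.inner_single_left]

lemma integral_neg_coord_sphereProb {n : ℕ} (m : ℝ) (i : Fin n) (g : (Fin n → ℝ) → ℝ) :
    ∫ y, g (fun t => if t = i then -y t else y t) ∂(sphereProb n m) =
      ∫ y, g (fun t => y t) ∂(sphereProb n m) := by
  rw [← integral_reflect_sphereProb m (EuclideanSpace.single i 1) g]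
  congr 1 with y
  congr 1 with t
  simp only [inner_single_self]
  by_cases h : t = i
  · subst h; simp; ring
  · simp [h]

/-- Invariance under the reflection in the vector `eᵢ + c eⱼ`, in coordinates. -/
lemma integral_reflect_pair_sphereProb {n : ℕ} (m c : ℝ) {i j : Fin n} (hij : i ≠ j)
    (g : ℝ → ℝ → ℝ) :
    ∫ y, g (y i - 2 * ((y i + c * y j) / (1 + c ^ 2)))
      (y j - 2 * ((y i + c * y j) / (1 + c ^ 2)) * c) ∂(sphereProb n m) =
      ∫ y, g (y i) (y j) ∂(sphereProb n m) := by
  rw [← integral_reflect_sphereProb m (EuclideanSpace.single i 1 + EuclideanSpace.single j c)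
    (fun y => g (y i) (y j))]
  congr 1 with y
  simp only [inner_add_left, inner_single_self]
  simp [hij, hij.symm, pow_two]

lemma isQuinticMoments_sphereProb {n : ℕ} (hn : 0 < n) {m : ℝ} (hm : 0 ≤ m) :
    IsQuinticMoments m (fun d : Fin n → ℕ => ∫ y, ∏ t, y t ^ d t ∂(sphereProb n m)) where
  zero := by
    have := isProbabilityMeasure_sphereProb hn m
    simp
  odd d i hi := by
    have h := integral_neg_coord_sphereProb m i (fun y => ∏ t, y t ^ d t)
    simp only [prod_pow_neg_coord _ _ _ hi, integral_neg] at h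
    linarith
  radial d := by
    rw [← integral_finsetSum _ fun j _ => integrable_sphereProb hn m (by fun_prop),
      ← integral_const_mul]
    refine integral_congr_ae ?_
    have h : ∀ᵐ y ∂(sphereProb n m), y ∈ sphereOfNorm n m := sphereProb_compl_sphereOfNorm n hm
    filter_upwards [h] with y hy
    simp only [prod_pow_add, prod_pow_single, ← Finset.mul_sum]
    rw [mul_comm]
    congr 1
    rw [← show inner ℝ y y = m from hy, PiLp.inner_apply]
    simp [pow_two]
  second i j := by
    by_cases hij : i = j
    · rw [hij]
    have h := integral_reflect_pair_sphereProb m (-1) hij (fun a _ => a ^ 2)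
    simp only [prod_pow_single]
    rw [← h]
    congr 1 with y
    ring
  fourth i j hij := by
    -- The reflection in `eᵢ - 2eⱼ` sends `y i` to `(3 * y i + 4 * y j) / 5`. Averaging its fourth
    -- power over the sign of `y j` removes the odd terms and leaves `576 * M₄ = 1728 * M₂₂`, with
    -- `M₄`, `M₂₂` the two quartic moments.
    have h := integral_reflect_pair_sphereProb m (-2) hij (fun a _ => a ^ 4)
    have h' := integral_reflect_pair_sphereProb m (-1) hij (fun a _ => a ^ 4)
    have h2 := integral_neg_coord_sphereProb m j
      (fun y => (y i - 2 * ((y i + (-2) * y j) / (1 + (-2) ^ 2))) ^ 4)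
    have hi : ∀ f : EuclideanSpace ℝ (Fin n) → ℝ, Continuous f → Integrable f (sphereProb n m) :=
      fun f hf => integrable_sphereProb hn m hf
    simp only [prod_pow_add, prod_pow_single]
    have h3 : ∫ y, (y i - 2 * ((y i + (-2) * y j) / (1 + (-2) ^ 2))) ^ 4 ∂(sphereProb n m) +
        ∫ y, (y i - 2 * ((y i + (-2) * (-y j)) / (1 + (-2) ^ 2))) ^ 4 ∂(sphereProb n m) =
        162 / 625 * ∫ y, y i ^ 4 ∂(sphereProb n m) +
        512 / 625 * ∫ y, y j ^ 4 ∂(sphereProb n m) +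
        1728 / 625 * ∫ y, y i ^ 2 * y j ^ 2 ∂(sphereProb n m) := by
      rw [← integral_const_mul, ← integral_const_mul, ← integral_const_mul,
        ← integral_add (hi _ (by fun_prop)) (hi _ (by fun_prop)),
        ← integral_add (hi _ (by fun_prop)) (hi _ (by fun_prop)),
        ← integral_add (hi _ (by fun_prop)) (hi _ (by fun_prop))]
      congr 1 with y
      ring
    have h4 : ∫ y, y j ^ 4 ∂(sphereProb n m) = ∫ y, y i ^ 4 ∂(sphereProb n m) := by
      rw [← h']
      congr 1 with y
      ring
    simp only [if_neg hij, if_true] at h2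
    rw [h2, h, h4] at h3
    linarith

/-! ### Shells of the cubic lattice and a design criterion. -/

/-- The integer vectors of norm `m`, as a finite set. -/
noncomputable def intShell (n m : ℕ) : Finset (Fin n → ℤ) :=
  (Fintype.piFinset fun _ => Finset.Icc (-(m : ℤ)) m).filter fun x => ∑ i, x i ^ 2 = m

lemma mem_intShell {n m : ℕ} {x : Fin n → ℤ} : x ∈ intShell n m ↔ ∑ i, x i ^ 2 = m := by
  simp only [intShell, Finset.mem_filter, Fintype.mem_piFinset, Finset.mem_Icc,
    and_iff_right_iff_imp]
  intro h i
  have h1 : x i ^ 2 ≤ m := h ▸ Finset.single_le_sum (fun j _ => sq_nonneg (x j)) (Finset.mem_univ i)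
  constructor <;> nlinarith

/-- The inclusion of `ℤⁿ` in `ℝⁿ`. -/
def intVec {n : ℕ} (x : Fin n → ℤ) : EuclideanSpace ℝ (Fin n) := WithLp.toLp 2 fun i => (x i : ℝ)

lemma intVec_injective {n : ℕ} : Function.Injective (intVec (n := n)) := by
  intro x y h
  ext i
  have := congrArg (fun v : EuclideanSpace ℝ (Fin n) => v i) h
  simpa [intVec] using this

lemma shell_cubicLattice (n m : ℕ) :
    shell (cubicLattice n) (m : ℝ) = intVec '' (intShell n m : Set (Fin n → ℤ)) := by
  have key : ∀ x : Fin n → ℤ, intVec x ∈ sphereOfNorm n m ↔ x ∈ intShell n m := by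
    intro x
    rw [mem_intShell, ← @Int.cast_inj ℝ]
    simp [sphereOfNorm, intVec, PiLp.norm_sq_eq_of_L2]
  ext v
  constructor
  · rintro ⟨hv, hs⟩
    choose x hx using hv
    obtain rfl : intVec x = v := by
      ext i
      simp [intVec, hx]
    exact ⟨x, (key x).1 hs, rfl⟩
  · rintro ⟨x, hx, rfl⟩
    exact ⟨fun i => ⟨x i, rfl⟩, (key x).2 hx⟩

/-- The vector `x` with its `i`-th coordinate negated. -/
def negCoord {n : ℕ} (i : Fin n) (x : Fin n → ℤ) : Fin n → ℤ := fun t => if t = i then -x t else x t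

lemma negCoord_negCoord {n : ℕ} (i : Fin n) (x : Fin n → ℤ) : negCoord i (negCoord i x) = x := by
  ext t
  by_cases h : t = i <;> simp [negCoord, h]

lemma negCoord_mem_intShell {n m : ℕ} (i : Fin n) {x : Fin n → ℤ} (hx : x ∈ intShell n m) :
    negCoord i x ∈ intShell n m := by
  rw [mem_intShell] at *
  rw [← hx]
  refine Finset.sum_congr rfl fun t _ => ?_
  by_cases h : t = i <;> simp [negCoord, h]

lemma sum_comp_involution {α R : Type*} [AddCommMonoid R] {T : Finset α} {s : α → α}
    (hs : ∀ x ∈ T, s (s x) = x) (hT : ∀ x ∈ T, s x ∈ T) (g : α → R) :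
    ∑ x ∈ T, g (s x) = ∑ x ∈ T, g x :=
  Finset.sum_nbij' s s hT hT hs hs fun _ _ => rfl

lemma comp_perm_mem_intShell {n m : ℕ} (e : Equiv.Perm (Fin n)) {x : Fin n → ℤ} :
    x ∘ e ∈ intShell n m ↔ x ∈ intShell n m := by
  rw [mem_intShell, mem_intShell, ← Equiv.sum_comp e fun i => x i ^ 2]
  rfl

lemma sum_intShell_comp_perm {n m : ℕ} {R : Type*} [AddCommMonoid R] (e : Equiv.Perm (Fin n))
    (g : (Fin n → ℤ) → R) : ∑ x ∈ intShell n m, g (x ∘ e) = ∑ x ∈ intShell n m, g x := by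
  refine Finset.sum_nbij' (fun x => x ∘ e) (fun x => x ∘ e.symm)
    (fun x hx => (comp_perm_mem_intShell e).2 hx)
    (fun x hx => (comp_perm_mem_intShell e.symm).2 hx) ?_ ?_ fun _ _ => rfl
  · intro x _
    ext t
    simp
  · intro x _
    ext t
    simp

lemma sum_intShell_coord {n m : ℕ} (i j : Fin n) (g : ℤ → ℤ) :
    ∑ x ∈ intShell n m, g (x i) = ∑ x ∈ intShell n m, g (x j) := by
  rw [← sum_intShell_comp_perm (Equiv.swap i j) fun x => g (x i)]
  simp

lemma sum_intShell_pair {n m : ℕ} {i j k l : Fin n} (hij : i ≠ j) (hkl : k ≠ l) (g : ℤ → ℤ → ℤ) :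
    ∑ x ∈ intShell n m, g (x i) (x j) = ∑ x ∈ intShell n m, g (x k) (x l) := by
  obtain ⟨e, he⟩ := Equiv.Perm.exists_extending_pair (![k, l] : Fin 2 → Fin n) ![i, j]
    (by intro a b; fin_cases a <;> fin_cases b <;> simp [hkl, hkl.symm])
    (by intro a b; fin_cases a <;> fin_cases b <;> simp [hij, hij.symm])
  have hk : e k = i := he 0
  have hl : e l = j := he 1
  rw [← sum_intShell_comp_perm e fun x => g (x k) (x l)]
  simp [hk, hl]

/-- A shell of `ℤⁿ` is a spherical `5`-design as soon as the average over it of one quartic harmonic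
polynomial vanishes. -/
lemma isSphericalDesign_shell {n m : ℕ} (hn : 0 < n) (hne : (intShell n m).Nonempty)
    (h : ∀ i j, i ≠ j → ∑ x ∈ intShell n m, x i ^ 4 = 3 * ∑ x ∈ intShell n m, x i ^ 2 * x j ^ 2) :
    IsSphericalDesign 5 (m : ℝ) (shell (cubicLattice n) (m : ℝ)) := by
  have hN : ((intShell n m).card : ℝ) ≠ 0 := by exact_mod_cast hne.card_pos.ne'
  have hM : IsQuinticMoments (m : ℝ) fun d : Fin n → ℕ =>
      (1 / ((intShell n m).card : ℝ)) * ∑ x ∈ intShell n m, ∏ t, (x t : ℝ) ^ d t :=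
    { zero := by simp [hN]
      odd := fun d i hi => by
        have e := sum_comp_involution (fun x _ => negCoord_negCoord i x)
          (fun x hx => negCoord_mem_intShell (m := m) i hx) fun x => ∏ t, (x t : ℝ) ^ d t
        have e' : ∀ x : Fin n → ℤ, ∏ t, (negCoord i x t : ℝ) ^ d t = -∏ t, (x t : ℝ) ^ d t := by
          intro x
          rw [← prod_pow_neg_coord _ _ i hi]
          simp [negCoord, apply_ite]
        simp only [e', Finset.sum_neg_distrib] at e
        have e0 : ∑ x ∈ intShell n m, ∏ t, (x t : ℝ) ^ d t = 0 := by linarith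
        rw [e0, mul_zero]
      radial := fun d => by
        rw [← Finset.mul_sum, Finset.sum_comm, mul_left_comm, Finset.mul_sum (a := (m : ℝ))]
        congr 1
        refine Finset.sum_congr rfl fun x hx => ?_
        simp only [prod_pow_add, prod_pow_single, ← Finset.mul_sum]
        rw [mul_comm]
        congr 1
        exact_mod_cast mem_intShell.1 hx
      second := fun i j => by
        simp only [prod_pow_single]
        congr 1
        exact_mod_cast sum_intShell_coord i j fun a => a ^ (2 : ℕ)
      fourth := fun i j hij => by
        simp only [prod_pow_add, prod_pow_single]
        rw [mul_left_comm]
        congr 1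
        exact_mod_cast h i j hij }
  have hfin : (shell (cubicLattice n) (m : ℝ)).Finite := by
    rw [shell_cubicLattice]
    exact (Finset.finite_toSet _).image _
  have hfs : hfin.toFinset = (intShell n m).map ⟨intVec, intVec_injective⟩ := by
    ext v
    simp [shell_cubicLattice]
  refine ⟨?_, hfin, Set.inter_subset_right, fun P hP => ?_⟩
  · rw [shell_cubicLattice]
    exact (Finset.coe_nonempty.2 hne).image _
  · rw [Set.ncard_eq_toFinset_card _ hfin, hfs, Finset.card_map, Finset.sum_map]
    simp only [MvPolynomial.eval_eq']
    rw [integral_finsetSum _ fun d _ => integrable_sphereProb hn _ (by fun_prop), Finset.sum_comm,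
      Finset.mul_sum]
    refine Finset.sum_congr rfl fun d hd => ?_
    rw [integral_const_mul, ← Finset.mul_sum, mul_left_comm]
    congr 1
    refine hM.eq_of_sum_le hn (isQuinticMoments_sphereProb hn m.cast_nonneg) (d := d) ?_
    refine le_trans ?_ ((MvPolynomial.le_totalDegree hd).trans hP)
    rw [Finsupp.sum_fintype _ _ fun _ => rfl]

/-! ### Reflections in blocks of four coordinates. -/

/-- Up to sign changes, the reflection in the vector `∑ i ∈ Q, eᵢ`, for a set `Q` of four indices and
vectors `x` with `∑ i ∈ Q, x i` even. -/
def blockReflect {n : ℕ} (Q : Finset (Fin n)) (x : Fin n → ℤ) : Fin n → ℤ :=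
  fun t => if t ∈ Q then (∑ i ∈ Q, x i) / 2 - x t else x t

section blockReflect

variable {n : ℕ} {Q : Finset (Fin n)} {x : Fin n → ℤ}

lemma sum_inter_blockReflect (Q' : Finset (Fin n)) :
    ∑ t ∈ Q', blockReflect Q x t = ∑ t ∈ Q', x t +
      ((Q' ∩ Q).card * ((∑ i ∈ Q, x i) / 2) - 2 * ∑ t ∈ Q' ∩ Q, x t) := by
  have h : ∀ t, blockReflect Q x t =
      x t + if t ∈ Q then (∑ i ∈ Q, x i) / 2 - 2 * x t else 0 := by
    intro t
    by_cases ht : t ∈ Q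
    · simp [blockReflect, ht]; ring
    · simp [blockReflect, ht]
  simp only [h, Finset.sum_add_distrib, Finset.sum_ite_mem, Finset.sum_sub_distrib,
    Finset.sum_const, Finset.mul_sum, nsmul_eq_mul]

lemma sum_blockReflect (hQ : Q.card = 4) (hx : Even (∑ i ∈ Q, x i)) :
    ∑ t ∈ Q, blockReflect Q x t = ∑ t ∈ Q, x t := by
  obtain ⟨r, hr⟩ := hx
  rw [sum_inter_blockReflect, Finset.inter_self, hQ, hr]
  push_cast
  omega

lemma blockReflect_blockReflect (hQ : Q.card = 4) (hx : Even (∑ i ∈ Q, x i)) :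
    blockReflect Q (blockReflect Q x) = x := by
  ext t
  by_cases ht : t ∈ Q
  · rw [blockReflect, if_pos ht, sum_blockReflect hQ hx, blockReflect, if_pos ht]
    ring
  · simp [blockReflect, ht]

lemma blockReflect_mem_intShell {m : ℕ} (hQ : Q.card = 4) (hx : Even (∑ i ∈ Q, x i))
    (h : x ∈ intShell n m) : blockReflect Q x ∈ intShell n m := by
  rw [mem_intShell] at *
  have e : ∀ t, blockReflect Q x t ^ 2 = x t ^ 2 +
      if t ∈ Q then ((∑ i ∈ Q, x i) / 2) ^ 2 - 2 * ((∑ i ∈ Q, x i) / 2) * x t else 0 := by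
    intro t
    by_cases ht : t ∈ Q
    · simp [blockReflect, ht]; ring
    · simp [blockReflect, ht]
  obtain ⟨r, hr⟩ := hx
  simp only [e, Finset.sum_add_distrib, h, Finset.sum_ite_mem, Finset.univ_inter,
    Finset.sum_sub_distrib, Finset.sum_const, ← Finset.mul_sum, hQ, hr]
  rw [← two_mul, Int.mul_ediv_cancel_left _ two_ne_zero]
  ring

/-- Invariance under sign changes and under the reflection in `eᵢ + eⱼ + eₖ + eₗ` forces a relation
between the quartic moments. -/
lemma quartic_relation {T : Finset (Fin n → ℤ)} {i j k l : Fin n} (hij : i ≠ j) (hik : i ≠ k)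
    (hil : i ≠ l) (hjk : j ≠ k) (hjl : j ≠ l) (hkl : k ≠ l)
    (hneg : ∀ t, ∀ x ∈ T, negCoord t x ∈ T)
    (heven : ∀ x ∈ T, Even (∑ t ∈ {i, j, k, l}, x t))
    (hrefl : ∀ x ∈ T, blockReflect {i, j, k, l} x ∈ T) :
    ∑ x ∈ T, (x i ^ 4 + x j ^ 4 + x k ^ 4 + x l ^ 4 - 2 * (x i ^ 2 * x j ^ 2 + x i ^ 2 * x k ^ 2 +
      x i ^ 2 * x l ^ 2 + x j ^ 2 * x k ^ 2 + x j ^ 2 * x l ^ 2 + x k ^ 2 * x l ^ 2)) = 0 := by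
  have hQ : Finset.card {i, j, k, l} = 4 := by simp [*]
  have hs : ∀ x : Fin n → ℤ, ∑ t ∈ {i, j, k, l}, x t = x i + x j + x k + x l := by
    intro x
    simp [*, add_assoc]
  have neg : ∀ (t : Fin n) (g : (Fin n → ℤ) → ℤ), ∑ x ∈ T, g (negCoord t x) = ∑ x ∈ T, g x :=
    fun t g => sum_comp_involution (fun x _ => negCoord_negCoord t x) (hneg t) g
  -- The change of `x i ^ 4 + x j ^ 4 + x k ^ 4 + x l ^ 4` under the reflection, times `-4`.
  let g : ℤ → ℤ → ℤ → ℤ → ℤ := fun a b c d => (a + b + c + d) ^ 4 -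
    6 * (a + b + c + d) ^ 2 * (a ^ 2 + b ^ 2 + c ^ 2 + d ^ 2) +
    8 * (a + b + c + d) * (a ^ 3 + b ^ 3 + c ^ 3 + d ^ 3)
  have h0 : ∑ x ∈ T, g (x i) (x j) (x k) (x l) = 0 := by
    have h := sum_comp_involution (fun x hx => blockReflect_blockReflect hQ (heven x hx)) hrefl
      fun x => x i ^ 4 + x j ^ 4 + x k ^ 4 + x l ^ 4
    rw [← sub_eq_zero, ← Finset.sum_sub_distrib] at h
    have h' : ∑ x ∈ T, g (x i) (x j) (x k) (x l) = -4 * 0 := by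
      rw [← h, Finset.mul_sum]
      refine Finset.sum_congr rfl fun x hx => ?_
      obtain ⟨r, hr⟩ := heven x hx
      have hr2 : (∑ t ∈ {i, j, k, l}, x t) / 2 = r := by omega
      simp only [blockReflect, hr2, Finset.mem_insert, Finset.mem_singleton, true_or, or_true,
        if_true]
      rw [hs] at hr
      simp only [g]
      rw [show x i = r + r - x j - x k - x l by linarith]
      ring
    simpa using h'
  have e1 : ∑ x ∈ T, g (x i) (x j) (x k) (-x l) = 0 := by
    rw [← h0, ← neg l]; simp [negCoord, *]
  have e2 : ∑ x ∈ T, g (x i) (x j) (-x k) (x l) = 0 := by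
    rw [← h0, ← neg k]; simp [negCoord, *, hkl.symm]
  have e3 : ∑ x ∈ T, g (x i) (x j) (-x k) (-x l) = 0 := by
    rw [← e1, ← neg k]; simp [negCoord, *, hkl.symm]
  have e4 : ∑ x ∈ T, (g (x i) (x j) (x k) (x l) + g (x i) (x j) (x k) (-x l) +
      g (x i) (x j) (-x k) (x l) + g (x i) (x j) (-x k) (-x l)) = 0 := by
    simp only [Finset.sum_add_distrib, h0, e1, e2, e3]; rfl
  have e5 := neg j fun x => (g (x i) (x j) (x k) (x l) + g (x i) (x j) (x k) (-x l) +
      g (x i) (x j) (-x k) (x l) + g (x i) (x j) (-x k) (-x l))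
  rw [e4] at e5
  -- The sum over the eight signs of `x j`, `x k`, `x l` keeps only the monomials even in each
  -- variable (`g` itself is even), and `24 = 8 * 3`.
  have e6 : ∑ x ∈ T, 24 * (x i ^ 4 + x j ^ 4 + x k ^ 4 + x l ^ 4 - 2 * (x i ^ 2 * x j ^ 2 +
      x i ^ 2 * x k ^ 2 + x i ^ 2 * x l ^ 2 + x j ^ 2 * x k ^ 2 + x j ^ 2 * x l ^ 2 +
      x k ^ 2 * x l ^ 2)) = 0 + 0 := by
    rw [← e4]
    nth_rw 2 [e4]
    rw [← e5, ← Finset.sum_add_distrib]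
    refine Finset.sum_congr rfl fun x _ => ?_
    simp only [negCoord, g, if_true, if_neg hij, if_neg hjk.symm, if_neg hjl.symm]
    ring
  rw [← Finset.mul_sum] at e6
  simpa using e6

end blockReflect

/-! ### Nonempty shells, parity, and rank 4. -/

lemma intShell_nonempty {n : ℕ} (hn : 4 ≤ n) (m : ℕ) : (intShell n m).Nonempty := by
  obtain ⟨k, rfl⟩ := Nat.exists_eq_add_of_le hn
  obtain ⟨a, b, c, d, h⟩ := Nat.sum_four_squares m
  refine ⟨Fin.append ![(a : ℤ), b, c, d] 0, ?_⟩
  rw [mem_intShell, Fin.sum_univ_add]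
  simp [Fin.sum_univ_four]
  exact_mod_cast h

lemma even_sum_congr {ι : Type*} {x y : ι → ℤ} (h : ∀ i, Even (x i) ↔ Even (y i)) (s : Finset ι) :
    Even (∑ i ∈ s, x i) ↔ Even (∑ i ∈ s, y i) := by
  rw [← Int.even_add, ← Finset.sum_add_distrib]
  exact Finset.even_sum _ fun i _ => Int.even_add.2 (h i)

lemma even_sum_of_mem_intShell {n m : ℕ} (hm : Even m) {x : Fin n → ℤ} (hx : x ∈ intShell n m) :
    Even (∑ i, x i) := by
  rw [even_sum_congr (y := fun i => x i ^ 2) (fun i => by simp [Int.even_pow]), mem_intShell.1 hx]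
  exact_mod_cast hm

lemma isSphericalDesign_shell_four {m : ℕ} (hm : Even m) :
    IsSphericalDesign 5 (m : ℝ) (shell (cubicLattice 4) (m : ℝ)) := by
  refine isSphericalDesign_shell four_pos (intShell_nonempty le_rfl m) fun i j hij => ?_
  have hu : ({0, 1, 2, 3} : Finset (Fin 4)) = Finset.univ := rfl
  have h := quartic_relation (T := intShell 4 m) (i := 0) (j := 1) (k := 2) (l := 3)
    (by decide) (by decide) (by decide) (by decide) (by decide) (by decide)
    (fun t x hx => negCoord_mem_intShell t hx)
    (fun x hx => by rw [hu]; exact even_sum_of_mem_intShell hm hx)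
    (fun x hx => blockReflect_mem_intShell rfl
      (by rw [hu]; exact even_sum_of_mem_intShell hm hx) hx)
  have h4 : ∀ k, ∑ x ∈ intShell 4 m, x k ^ 4 = ∑ x ∈ intShell 4 m, x i ^ 4 :=
    fun k => sum_intShell_coord k i fun a => a ^ 4
  have h22 : ∀ k l, k ≠ l → ∑ x ∈ intShell 4 m, x k ^ 2 * x l ^ 2 =
      ∑ x ∈ intShell 4 m, x i ^ 2 * x j ^ 2 :=
    fun k l hkl => sum_intShell_pair hkl hij fun a b => a ^ 2 * b ^ 2
  simp only [Finset.sum_sub_distrib, Finset.sum_add_distrib, ← Finset.mul_sum, h4,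
    h22 0 1 (by decide), h22 0 2 (by decide), h22 0 3 (by decide), h22 1 2 (by decide),
    h22 1 3 (by decide), h22 2 3 (by decide)] at h
  linarith

/-! ### Rank 7: the Hamming code lattice. -/

/-- The complements of the lines of the Fano plane. -/
def fanoBlock (k : Fin 7) : Finset (Fin 7) := {k + 2, k + 4, k + 5, k + 6}

lemma card_fanoBlock (k : Fin 7) : (fanoBlock k).card = 4 := by
  revert k; decide

lemma even_card_fanoBlock_inter (k l : Fin 7) : Even (fanoBlock k ∩ fanoBlock l).card := by
  revert k l; decide

/-- The vectors of norm `m` in the lattice of the `x ∈ ℤ⁷` that reduce modulo `2` to the Hamming code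
(a copy of the dual of the root lattice `E₇`, scaled by `√2`). -/
noncomputable def hammingShell (m : ℕ) : Finset (Fin 7 → ℤ) :=
  (intShell 7 m).filter fun x => ∀ k, Even (∑ i ∈ fanoBlock k, x i)

lemma negCoord_mem_hammingShell {m : ℕ} (t : Fin 7) {x : Fin 7 → ℤ} (hx : x ∈ hammingShell m) :
    negCoord t x ∈ hammingShell m := by
  rw [hammingShell, Finset.mem_filter] at *
  refine ⟨negCoord_mem_intShell t hx.1, fun k => ?_⟩
  rw [even_sum_congr (y := x)]
  · exact hx.2 k
  · intro i
    by_cases h : i = t <;> simp [negCoord, h]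

/-- The half-sum added on a block may be odd, but blocks meet in an even number of indices, so all
block parities survive. -/
lemma blockReflect_mem_hammingShell {m : ℕ} (k : Fin 7) {x : Fin 7 → ℤ}
    (hx : x ∈ hammingShell m) : blockReflect (fanoBlock k) x ∈ hammingShell m := by
  rw [hammingShell, Finset.mem_filter] at *
  refine ⟨blockReflect_mem_intShell (card_fanoBlock k) (hx.2 k) hx.1, fun l => ?_⟩
  rw [sum_inter_blockReflect]
  refine (hx.2 l).add (Even.sub (Even.mul_right ?_ _) (even_two_mul _))
  exact_mod_cast even_card_fanoBlock_inter l k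

/-- A quartic polynomial whose mean over the sphere of square radius `m` vanishes. -/
def quarticDefect (m : ℕ) (x : Fin 7 → ℤ) : ℤ := 3 * ∑ i, x i ^ 4 - m ^ 2

/-- Add `quartic_relation` over the seven blocks: each index lies in four blocks and each pair in
two, giving `6 * ∑ x i ^ 4 - 2 * m ^ 2`. -/
lemma sum_quarticDefect_hammingShell (m : ℕ) : ∑ x ∈ hammingShell m, quarticDefect m x = 0 := by
  have h : ∀ k : Fin 7, _ := fun k =>
    quartic_relation (T := hammingShell m) (i := k + 2) (j := k + 4) (k := k + 5) (l := k + 6)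
      (by simp) (by simp) (by simp) (by simp) (by simp) (by simp)
      (fun t x hx => negCoord_mem_hammingShell t hx)
      (fun x hx => (Finset.mem_filter.1 hx).2 k)
      (fun x hx => blockReflect_mem_hammingShell k hx)
  have h' := Finset.sum_eq_zero (s := Finset.univ) fun k _ => h k
  rw [Finset.sum_comm] at h'
  have h2 : 2 * ∑ x ∈ hammingShell m, quarticDefect m x = 0 := by
    rw [← h', Finset.mul_sum]
    refine Finset.sum_congr rfl fun x hx => ?_
    have hm := mem_intShell.1 (Finset.mem_filter.1 hx).1
    rw [quarticDefect, ← hm]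
    simp [Fin.sum_univ_seven]
    ring
  simpa using h2

/-! ### Rank 7: layers by odd support. -/

/-- The set of indices of the odd coordinates of `x`. -/
def oddSupport (x : Fin 7 → ℤ) : Finset (Fin 7) := Finset.univ.filter fun i => Odd (x i)

/-- The sum of `quarticDefect m` over the vectors of norm `m` with a given odd support. -/
noncomputable def layerSum (m : ℕ) (B : Finset (Fin 7)) : ℤ :=
  ∑ x ∈ intShell 7 m with oddSupport x = B, quarticDefect m x

lemma sum_layerSum (m : ℕ) : ∑ B, layerSum m B = ∑ x ∈ intShell 7 m, quarticDefect m x :=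
  Finset.sum_fiberwise _ _ _

lemma layerSum_eq_zero_of_forall {m : ℕ} {B : Finset (Fin 7)}
    (h : ∀ x ∈ intShell 7 m, oddSupport x ≠ B) : layerSum m B = 0 := by
  rw [layerSum, Finset.filter_eq_empty_iff.2 fun x hx => h x hx, Finset.sum_empty]

lemma layerSum_eq_of_card_eq (m : ℕ) {B B' : Finset (Fin 7)} (h : B.card = B'.card) :
    layerSum m B = layerSum m B' := by
  obtain ⟨e, he⟩ := Equiv.Perm.exists_map_finset_eq B B' h
  rw [layerSum, layerSum, Finset.sum_filter, Finset.sum_filter,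
    ← sum_intShell_comp_perm e fun x => if oddSupport x = B then quarticDefect m x else 0]
  refine Finset.sum_congr rfl fun x _ => ?_
  have h1 : (oddSupport (x ∘ e)).map e.toEmbedding = oddSupport x := by
    ext t
    simp only [oddSupport, Finset.mem_map_equiv, Finset.mem_filter, Finset.mem_univ, true_and,
      Function.comp_apply, Equiv.apply_symm_apply]
  have h2 : oddSupport (x ∘ e) = B ↔ oddSupport x = B' := by
    rw [← he, ← h1, Finset.map_inj]
  have h3 : quarticDefect m (x ∘ e) = quarticDefect m x := by
    simp only [quarticDefect, Function.comp_apply]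
    rw [Equiv.sum_comp e fun i => x i ^ 4]
  simp only [h2, h3]

/-- The indicator vector of a set of indices. -/
def indicatorVec (B : Finset (Fin 7)) : Fin 7 → ℤ := fun i => if i ∈ B then 1 else 0

lemma even_indicatorVec_oddSupport (x : Fin 7 → ℤ) (i : Fin 7) :
    Even (x i) ↔ Even (indicatorVec (oddSupport x) i) := by
  by_cases h : Odd (x i)
  · simp [indicatorVec, oddSupport, h, Int.not_even_iff_odd.2 h]
  · simp [indicatorVec, oddSupport, h, Int.not_odd_iff_even.1 h]

lemma sum_layerSum_hamming (m : ℕ) :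
    ∑ B with ∀ k, Even (∑ i ∈ fanoBlock k, indicatorVec B i), layerSum m B = 0 := by
  rw [← sum_quarticDefect_hammingShell m, hammingShell,
    ← Finset.sum_fiberwise _ oddSupport, Finset.sum_filter]
  refine Finset.sum_congr rfl fun B _ => ?_
  rw [Finset.filter_filter]
  split_ifs with hB
  · refine Finset.sum_congr (Finset.filter_congr fun x _ => ?_) fun _ _ => rfl
    refine ⟨?_, fun h => h.2⟩
    rintro rfl
    exact ⟨fun k => (even_sum_congr (even_indicatorVec_oddSupport x) _).2 (hB k), rfl⟩
  · symm
    refine Finset.sum_eq_zero fun x hx => absurd (fun k => ?_) hB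
    obtain ⟨_, h, rfl⟩ := Finset.mem_filter.1 hx
    exact (even_sum_congr (even_indicatorVec_oddSupport x) _).1 (h k)

/-- If only the layers of one weight, that of a word of the Hamming code, can contribute, then none
of them does. -/
lemma layerSum_eq_zero {m : ℕ} {C : Finset (Fin 7)}
    (hC : ∀ k, Even (∑ i ∈ fanoBlock k, indicatorVec C i))
    (h : ∀ B, B.card ≠ C.card → layerSum m B = 0) (B : Finset (Fin 7)) : layerSum m B = 0 := by
  by_cases hB : B.card = C.card
  · have h1 := sum_layerSum_hamming m
    have h2 : ∀ D : Finset (Fin 7), layerSum m D = if D.card = C.card then layerSum m B else 0 := by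
      intro D
      split_ifs with hD
      · exact layerSum_eq_of_card_eq m (hD.trans hB.symm)
      · exact h D hD
    -- The Hamming sum is now `layerSum m B` times the number of codewords of the weight of `C`,
    -- which is positive because `C` is one.
    rw [Finset.sum_congr rfl fun D _ => h2 D, ← Finset.sum_filter, Finset.sum_const,
      smul_eq_zero] at h1
    refine h1.resolve_left (Finset.card_pos.2 ⟨C, ?_⟩).ne'
    simp [hC]
  · exact h B hB

lemma four_dvd_sub_card_oddSupport {m : ℕ} {x : Fin 7 → ℤ} (hx : x ∈ intShell 7 m) :
    (4 : ℤ) ∣ m - (oddSupport x).card := by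
  have h : (m : ℤ) - (oddSupport x).card = ∑ i, (x i ^ 2 - if Odd (x i) then 1 else 0) := by
    rw [Finset.sum_sub_distrib, mem_intShell.1 hx, oddSupport]
    simp
  rw [h]
  refine Finset.dvd_sum fun i _ => ?_
  split_ifs with hi
  · obtain ⟨r, hr⟩ := hi
    exact ⟨r ^ 2 + r, by rw [hr]; ring⟩
  · obtain ⟨r, hr⟩ := Int.not_odd_iff_even.1 hi
    exact ⟨r ^ 2, by rw [hr]; ring⟩

lemma eight_dvd_sub_seven {m : ℕ} {x : Fin 7 → ℤ} (hx : x ∈ intShell 7 m)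
    (hodd : (oddSupport x).card = 7) : (8 : ℤ) ∣ m - 7 := by
  have hu : oddSupport x = Finset.univ := Finset.card_eq_iff_eq_univ _ |>.1 hodd
  have h : (m : ℤ) - 7 = ∑ i, (x i ^ 2 - 1) := by
    rw [Finset.sum_sub_distrib, mem_intShell.1 hx]
    simp
  rw [h]
  refine Finset.dvd_sum fun i _ => ?_
  have hi : i ∈ oddSupport x := hu ▸ Finset.mem_univ i
  obtain ⟨r, hr⟩ := (Finset.mem_filter.1 hi).2
  obtain ⟨s, hs⟩ := Int.even_mul_succ_self r
  exact ⟨s, by rw [hr]; linear_combination 4 * hs⟩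

/-- Doubling is a bijection onto the all-even vectors, and `quarticDefect` scales by `2 ^ 4`. -/
lemma layerSum_empty (m : ℕ) :
    layerSum (4 * m) ∅ = 16 * ∑ x ∈ intShell 7 m, quarticDefect m x := by
  rw [Finset.mul_sum]
  symm
  have h0 : ∀ x : Fin 7 → ℤ, oddSupport x = ∅ ↔ ∀ i, Even (x i) := by
    intro x
    simp [oddSupport, Finset.filter_eq_empty_iff]
  refine Finset.sum_nbij' (fun x i => 2 * x i) (fun x i => x i / 2) ?_ ?_ ?_ ?_ ?_
  · intro x hx
    rw [Finset.mem_filter, h0, mem_intShell]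
    refine ⟨?_, fun i => even_two_mul _⟩
    simp only [mul_pow, ← Finset.mul_sum, mem_intShell.1 hx]
    push_cast
    ring
  · intro x hx
    rw [Finset.mem_filter, h0, mem_intShell] at hx
    rw [mem_intShell]
    have h : ∑ i, x i ^ 2 = 4 * ∑ i, (x i / 2) ^ 2 := by
      rw [Finset.mul_sum]
      refine Finset.sum_congr rfl fun i _ => ?_
      nth_rw 1 [← Int.two_mul_ediv_two_of_even (hx.2 i)]
      ring
    have := hx.1
    push_cast at this
    linarith
  · intro x _
    ext i
    simp
  · intro x hx
    rw [Finset.mem_filter, h0] at hx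
    ext i
    exact Int.two_mul_ediv_two_of_even (hx.2 i)
  · intro x _
    simp only [quarticDefect, mul_pow, ← Finset.mul_sum]
    push_cast
    ring

lemma even_sum_indicatorVec_three (k : Fin 7) :
    Even (∑ i ∈ fanoBlock k, indicatorVec {0, 1, 3} i) := by
  revert k; decide +kernel

lemma even_sum_indicatorVec_four (k : Fin 7) :
    Even (∑ i ∈ fanoBlock k, indicatorVec {2, 4, 5, 6} i) := by
  revert k; decide +kernel

lemma card_oddSupport_le (x : Fin 7 → ℤ) : (oddSupport x).card ≤ 7 := card_finset_fin_le _

/-- Squares modulo 4 leave weights 3 and 7; weight 7 would force `m ≡ 7 (mod 8)`. The Fano line `{0,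
1, 3}` is a codeword of weight 3. -/
lemma sum_quarticDefect_of_mod_eight {m : ℕ} (hm : m % 8 = 3) :
    ∑ x ∈ intShell 7 m, quarticDefect m x = 0 := by
  rw [← sum_layerSum]
  refine Finset.sum_eq_zero fun B _ => layerSum_eq_zero (C := {0, 1, 3})
    even_sum_indicatorVec_three (fun B hB => ?_) B
  replace hB : B.card ≠ 3 := hB
  refine layerSum_eq_zero_of_forall fun x hx h => ?_
  rw [← h] at hB
  have h4 := four_dvd_sub_card_oddSupport hx
  have h8 := eight_dvd_sub_seven hx
  have := card_oddSupport_le x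
  omega

/-- Only weights 0 and 4 occur. The hypothesis kills weight 0, and the codeword `{2, 4, 5, 6}`
handles weight 4. -/
lemma sum_quarticDefect_four_mul {m : ℕ} (hm : ∑ x ∈ intShell 7 m, quarticDefect m x = 0) :
    ∑ x ∈ intShell 7 (4 * m), quarticDefect (4 * m) x = 0 := by
  rw [← sum_layerSum]
  refine Finset.sum_eq_zero fun B _ => layerSum_eq_zero (C := {2, 4, 5, 6})
    even_sum_indicatorVec_four (fun B hB => ?_) B
  replace hB : B.card ≠ 4 := hB
  by_cases hB0 : B = ∅
  · rw [hB0, layerSum_empty, hm, mul_zero]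
  refine layerSum_eq_zero_of_forall fun x hx h => ?_
  rw [← h] at hB
  have h4 := four_dvd_sub_card_oddSupport hx
  have := card_oddSupport_le x
  rw [← Finset.card_eq_zero, ← h] at hB0
  push_cast at h4
  omega

lemma sum_quarticDefect_intShell (a b : ℕ) :
    ∑ x ∈ intShell 7 (4 ^ a * (8 * b + 3)), quarticDefect (4 ^ a * (8 * b + 3)) x = 0 := by
  induction a with
  | zero => exact sum_quarticDefect_of_mod_eight (by omega)
  | succ a ih =>
    rw [pow_succ', mul_assoc]
    exact sum_quarticDefect_four_mul ih

lemma isSphericalDesign_shell_seven {m : ℕ}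
    (h : ∑ x ∈ intShell 7 m, quarticDefect m x = 0) :
    IsSphericalDesign 5 (m : ℝ) (shell (cubicLattice 7) (m : ℝ)) := by
  refine isSphericalDesign_shell (by norm_num) (intShell_nonempty (by norm_num) m)
    fun i j hij => ?_
  have h4 : ∀ k, ∑ x ∈ intShell 7 m, x k ^ 4 = ∑ x ∈ intShell 7 m, x i ^ 4 :=
    fun k => sum_intShell_coord k i fun a => a ^ 4
  have h22 : ∀ k l, ∑ x ∈ intShell 7 m, x k ^ 2 * x l ^ 2 =
      ∑ x ∈ intShell 7 m, x i ^ 2 * x j ^ 2 + if k = l then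
        ∑ x ∈ intShell 7 m, x i ^ 4 - ∑ x ∈ intShell 7 m, x i ^ 2 * x j ^ 2 else 0 := by
    intro k l
    split_ifs with hkl
    · subst hkl
      rw [← h4 k, add_sub_cancel]
      exact Finset.sum_congr rfl fun x _ => by ring
    · rw [add_zero]
      exact sum_intShell_pair hkl hij fun a b => a ^ 2 * b ^ 2
  have e1 : ∑ x ∈ intShell 7 m, (m : ℤ) ^ 2 =
      ∑ k, ∑ l, ∑ x ∈ intShell 7 m, x k ^ 2 * x l ^ 2 := by
    rw [Finset.sum_congr rfl fun k _ => Finset.sum_comm, Finset.sum_comm]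
    refine Finset.sum_congr rfl fun x hx => ?_
    rw [← Finset.sum_mul_sum, mem_intShell.1 hx, sq]
  have e2 : ∑ x ∈ intShell 7 m, ∑ k, x k ^ 4 = 7 * ∑ x ∈ intShell 7 m, x i ^ 4 := by
    rw [Finset.sum_comm, Finset.sum_congr rfl fun k _ => h4 k]
    simp
  simp only [quarticDefect, Finset.sum_sub_distrib, ← Finset.mul_sum] at h
  rw [e1, e2] at h
  -- Expanding `m ^ 2 = (∑ x k ^ 2) ^ 2` gives 7 diagonal and 42 off-diagonal terms, so the
  -- hypothesis becomes `14 * M₄ = 42 * M₂₂` for the quartic sums over the shell.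
  rw [Finset.sum_congr rfl fun k _ => Finset.sum_congr rfl fun l _ => h22 k l] at h
  simp only [Finset.sum_add_distrib, Finset.sum_ite_eq, Finset.mem_univ, if_true,
    Finset.sum_const, Finset.card_univ, Fintype.card_fin, nsmul_eq_mul] at h
  push_cast at h
  linarith

theorem mainTheorem12 :
    (∀ m : ℕ, 0 < m → Even m →
      IsSphericalDesign 5 (m : ℝ) (shell (cubicLattice 4) (m : ℝ))) ∧
    (∀ m : ℕ, 0 < m → (∃ a b : ℕ, m = 4 ^ a * (8 * b + 3)) →
      IsSphericalDesign 5 (m : ℝ) (shell (cubicLattice 7) (m : ℝ))) := by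
  refine ⟨fun m _ hm => isSphericalDesign_shell_four hm, ?_⟩
  rintro m _ ⟨a, b, rfl⟩
  exact isSphericalDesign_shell_seven (sum_quarticDefect_intShell a b)
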